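/- For $\ell\in\mathbb N=\{1,2,\dots\}$ let the N\"orlund numbers $B_n^{(\ell)}$ be defined by $\sum_{n\ge 0}B_n^{(\ell)}\frac{z^n}{n!}=\left(\frac{z}{e^z-1}\right)^{\ell}$, and let $$B_n^{(\ell)*}=\sum_{r=0}^{n}\binom{n+r}{2r}\frac{B_r^{(\ell)}}{n+r}\qquad(n\ge 1)$$ be the modified N\"orlund polynomials (evaluated at $\ell$). Let $\psi=\Gamma'/\Gamma$ be the digamma function, $H_m=\sum_{k=1}^m \frac1k$ (so $H_0=0$), and $\binom{x}{m}=\frac{x(x-1)\cdots(x-m+1)}{m!}$. Theorem. For every $\ell\in\mathbb N$ the generating function $F(z;\ell)=\sum_{n\ge1}B_n^{(\ell)*}z^n$, viewed as a formal power series, is given by $$F(z;\ell)=-\frac12\log z+\frac12\left[H_{\ell-1}-\frac{d^{\ell-1}}{dx^{\ell-1}}\left\{\binom{x-1}{\ell-1}\,\psi\!\left(x-\left\lfloor\tfrac{\ell}{2}\right\rfloor\right)\right\}\right]_{x=z+1/z+\ell-2}.$$ Here the equality is that of a function with its formal (asymptotic) expansion at $z=0$: if $G_\ell(z)$ denotes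 the right-hand side, with $\log$ the principal logarithm, then for every $\theta\in(0,\pi)$ and every integer $N\ge0$, $$G_\ell(z)=\sum_{1\le n<N}B_n^{(\ell)*}z^n+O(z^N)\qquad\text{as } z\to0,\ z\neq 0,\ |\arg z|\le\theta.$$ In particular this holds as $z\to0^+$ along the real axis, which determines all the coefficients $B_n^{(\ell)*}$. For $\ell=1$ this is Zagier's formula $\sum_{n\ge1}B_n^*z^n=-\frac12\log z-\frac12\psi(z+1/z-1)$. -/

import Mathlib

open Filter Topology Asymptotics

noncomputable section

/-- The Nörlund polynomial `B_n^{(ℓ)}` at a natural number `ℓ`: `n!` times the coefficient of `z ^ n`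
in `(z / (e ^ z - 1)) ^ ℓ`. Mathlib's `bernoulliPowerSeries ℚ` is the formal power series
`z / (e ^ z - 1)`, see `bernoulliPowerSeries_mul_exp_sub_one`. -/
def norlund (ℓ n : ℕ) : ℚ :=
  (n.factorial : ℚ) * PowerSeries.coeff n (bernoulliPowerSeries ℚ ^ ℓ)

/-- The modified Nörlund polynomial
`B_n^{(ℓ)*} = ∑_{r=0}^n binom(n+r, 2r) B_r^{(ℓ)} / (n+r)`, meant for `n ≥ 1`. -/
def modifiedNorlund (ℓ n : ℕ) : ℚ :=
  ∑ r ∈ Finset.range (n + 1), (Nat.choose (n + r) (2 * r) : ℚ) * (norlund ℓ r / ((n : ℚ) + (r : ℚ)))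

/-- The formal power series `F(z; ℓ) = ∑_{n ≥ 1} B_n^{(ℓ)*} z ^ n`. -/
def modifiedNorlundGenFun (ℓ : ℕ) : PowerSeries ℂ :=
  PowerSeries.mk fun n => if n = 0 then 0 else (modifiedNorlund ℓ n : ℂ)

/-- The generalized binomial coefficient `x (x - 1) ⋯ (x - k + 1) / k!`. -/
def genBinom (x : ℂ) (k : ℕ) : ℂ :=
  (∏ i ∈ Finset.range k, (x - (i : ℂ))) / (k.factorial : ℂ)

/-- The function `-½ log z + ½ [H_{ℓ-1} - (d/dx)^{ℓ-1} {binom(x-1, ℓ-1) ψ(x - ⌊ℓ/2⌋)}]`, with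
the derivative evaluated at `x = z + 1/z + ℓ - 2`, for `ℓ ≥ 1`. -/
def norlundClosedForm (ℓ : ℕ) (z : ℂ) : ℂ :=
  -(1 / 2) * Complex.log z
    + (1 / 2) * ((harmonic (ℓ - 1) : ℂ)
        - iteratedDeriv (ℓ - 1)
            (fun x : ℂ => genBinom (x - 1) (ℓ - 1) * Complex.digamma (x - ((ℓ / 2 : ℕ) : ℂ)))
            (z + 1 / z + (ℓ : ℂ) - 2))

/-- The formal power series `F` is the expansion of `f` at the origin (in the sense of Poincaré, since
`F` may diverge): in each closed sector `|arg z| ≤ θ` with `θ < π`, for each `N`,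
`f z = ∑_{n < N} F_n z ^ n + O(z ^ N)` as `z → 0`. -/
def HasFormalExpansionAtZero (f : ℂ → ℂ) (F : PowerSeries ℂ) : Prop :=
  ∀ θ : ℝ, 0 < θ → θ < Real.pi → ∀ N : ℕ,
    (fun z : ℂ => f z - ∑ n ∈ Finset.range N, PowerSeries.coeff n F * z ^ n)
      =O[𝓝[{z : ℂ | z ≠ 0 ∧ |Complex.arg z| ≤ θ}] 0] fun z : ℂ => z ^ N

end

/-! Put `w = z + 1/z - 2 = (1 - z)^2 / z`, so that `1/w = z / (1 - z)^2` and `log w = 2 log (1 - z)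
- log z`. Since `binom(n+r, 2r) / (n+r) = binom(n+r-1, 2r-1) / (2r)` is the coefficient of `z^n` in
`w^(-r) / (2r)`, formally `F(z; ℓ) = -log (1 - z) + ½ ∑_{r ≥ 1} B_r^(ℓ) / r · w^(-r)`. With `k = ℓ -
1` and `D_k(w) = (d/dw)^k {binom(w+k, k) ψ(w+1)}`, the theorem becomes `D_k(w) ~ log w + H_k - ∑_{r
≥ 1} B_r^(k+1) / r · w^(-r)` in sectors (`hasLogExpansion_derivBinomDigamma`).

This goes by induction on `k`. Leibniz' rule gives `D_{k+1} = (w+k+1)/(k+1) · D_k' + D_k`, and on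
coefficients this is the recurrence `norlund_succ_left`, a consequence of the differential equation
of `X / (exp X - 1)`. Expansions of holomorphic functions in sectors may be differentiated, by
Cauchy's estimate (`isBigO_deriv_sectorAtInf`).

The case `k = 0` is Stirling's expansion of `ψ(w+1)`. Its remainder has small increments under `w ↦
w + 1` (`isBigO_bernoulli_telescope`) and tends to `0` along `w + n`, so it is minus the sum of
these increments.

Finally, replacing `ψ(w+1)` by `ψ(w+j+1)`, `j ≤ k`, adds a polynomial of degree `< k`, which the
`k`-th derivative kills; this accounts for `⌊ℓ/2⌋`. -/

/-! ### Nörlund numbers and their recurrence in `ℓ`. -/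

theorem norlund_zero_right (ℓ : ℕ) : norlund ℓ 0 = 1 := by
  have h : PowerSeries.constantCoeff (bernoulliPowerSeries ℚ) = 1 := by
    rw [← PowerSeries.coeff_zero_eq_constantCoeff_apply]
    simp [bernoulliPowerSeries]
  simp [norlund, h]

theorem norlund_one_left (n : ℕ) : norlund 1 n = bernoulli n := by
  have : (n.factorial : ℚ) ≠ 0 := by positivity
  simp only [norlund, pow_one, bernoulliPowerSeries, PowerSeries.coeff_mk]
  simp
  field_simp

/-- The differential equation satisfied by `X / (exp X - 1)`. -/
theorem X_mul_derivative_bernoulliPowerSeries :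
    PowerSeries.X * PowerSeries.derivative ℚ (bernoulliPowerSeries ℚ)
      = bernoulliPowerSeries ℚ - bernoulliPowerSeries ℚ ^ 2
        - PowerSeries.X * bernoulliPowerSeries ℚ := by
  have h := bernoulliPowerSeries_mul_exp_sub_one ℚ
  set β := bernoulliPowerSeries ℚ
  have hd := congrArg (PowerSeries.derivative ℚ) h
  have he : PowerSeries.derivative ℚ (PowerSeries.exp ℚ) = PowerSeries.exp ℚ := by
    ext n
    simp only [PowerSeries.coeff_derivative, PowerSeries.coeff_exp, Nat.factorial_succ]
    have : (n.factorial : ℚ) ≠ 0 := by positivity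
    simp
    field_simp
  simp only [Derivation.leibniz, map_sub, he, smul_eq_mul, Derivation.map_one_eq_zero,
    PowerSeries.derivative_X] at hd
  set e := PowerSeries.exp ℚ
  have he0 : e - 1 ≠ 0 := by
    intro h0
    rw [h0, mul_zero] at h
    exact PowerSeries.X_ne_zero h.symm
  apply mul_right_cancel₀ he0
  linear_combination PowerSeries.X * hd + (β - 1) * h

theorem X_mul_derivative_bernoulliPowerSeries_pow (ℓ : ℕ) :
    PowerSeries.X * PowerSeries.derivative ℚ (bernoulliPowerSeries ℚ ^ ℓ)
      = (ℓ : PowerSeries ℚ) * (bernoulliPowerSeries ℚ ^ ℓ - bernoulliPowerSeries ℚ ^ (ℓ + 1)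
        - PowerSeries.X * bernoulliPowerSeries ℚ ^ ℓ) := by
  rcases ℓ with _ | k
  · simp
  · rw [Derivation.leibniz_pow]
    simp only [smul_eq_mul, nsmul_eq_mul, Nat.add_sub_cancel]
    linear_combination ((k + 1 : ℕ) : PowerSeries ℚ) * bernoulliPowerSeries ℚ ^ k *
      X_mul_derivative_bernoulliPowerSeries

/-- Comparison of the coefficients of `X^(r+1)` in the differential equation for the power `k + 1`.
-/
theorem norlund_succ_left (k r : ℕ) :
    norlund (k + 2) (r + 1) = norlund (k + 1) (r + 1)
      - ((r : ℚ) + 1) / (k + 1) * norlund (k + 1) (r + 1) - (r + 1) * norlund (k + 1) r := by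
  have h := congrArg (PowerSeries.coeff (r + 1)) (X_mul_derivative_bernoulliPowerSeries_pow (k + 1))
  rw [show ((k + 1 : ℕ) : PowerSeries ℚ) = PowerSeries.C ((k : ℚ) + 1) by simp] at h
  simp only [PowerSeries.coeff_succ_X_mul, PowerSeries.coeff_derivative, PowerSeries.coeff_C_mul,
    map_sub] at h
  have hk : (k : ℚ) + 1 ≠ 0 := by positivity
  simp only [norlund, Nat.factorial_succ]
  push_cast
  field_simp
  linear_combination h

/-! ### Taylor coefficients and binomial sums. -/

theorem isBigO_sub_sum_range_of_hasSum {f : ℂ → ℂ} {a : ℕ → ℂ}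
    (h : ∀ z : ℂ, ‖z‖ < 1 → HasSum (fun n => a n * z ^ n) (f z)) (N : ℕ) :
    (fun z => f z - ∑ n ∈ Finset.range N, a n * z ^ n) =O[𝓝 0] fun z => z ^ N := by
  have hf : HasFPowerSeriesOnBall f (FormalMultilinearSeries.ofScalars ℂ a) 0 1 := by
    refine ⟨?_, one_pos, ?_⟩
    · refine ENNReal.le_of_forall_nnreal_lt fun r hr => ?_
      apply FormalMultilinearSeries.le_radius_of_tendsto (l := 0)
      have hr1 : ‖((r : ℝ) : ℂ)‖ < 1 := by
        simp only [Complex.norm_real, NNReal.norm_eq]; exact_mod_cast hr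
      have := (h _ hr1).summable.tendsto_atTop_zero.norm
      simpa using this
    · intro y hy
      have hy1 : ‖y‖ < 1 := by
        rw [Metric.mem_eball, edist_zero_right, ← ofReal_norm] at hy
        exact ENNReal.ofReal_lt_one.1 hy
      simpa [FormalMultilinearSeries.ofScalars_apply_eq, mul_comm] using h y hy1
  have := hf.hasFPowerSeriesAt.isBigO_sub_partialSum_pow N
  simp only [FormalMultilinearSeries.partialSum,
    FormalMultilinearSeries.ofScalars_apply_eq, smul_eq_mul] at this
  have h2 : (fun y : ℂ => ‖y‖ ^ N) =O[𝓝 0] fun z : ℂ => z ^ N := isBigO_of_le _ fun y => by simp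
  refine (this.trans h2).congr_left fun z => ?_
  rw [zero_add]

theorem hasSum_pow_div_one_sub_pow (p q : ℕ) {z : ℂ} (hz : ‖z‖ < 1) :
    HasSum (fun m => (if m < p then 0 else ((m - p + q).choose q : ℂ)) * z ^ m)
      (z ^ p / (1 - z) ^ (q + 1)) := by
  rw [← hasSum_nat_add_iff' p, Finset.sum_eq_zero, sub_zero]
  · have := (hasSum_choose_mul_geometric_of_norm_lt_one q hz).mul_left (z ^ p)
    rw [mul_one_div] at this
    refine this.congr_fun fun n => ?_
    rw [if_neg (by omega), Nat.add_sub_cancel]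
    ring
  · intro i hi
    simp [Finset.mem_range.1 hi]

/-- The defining recurrence of the Bernoulli numbers, rewritten with `(k+1) binom(k, r) = (r+1)
binom(k+1, r+1)`. -/
theorem sum_bernoulli_mul_choose_div (k : ℕ) :
    ∑ r ∈ Finset.range k, bernoulli (r + 1) / (r + 1) * (k.choose r : ℚ)
      = (if k = 0 then 1 else 0) - 1 / (k + 1) := by
  have h := sum_bernoulli (k + 1)
  rw [Finset.sum_range_succ'] at h
  have hk : (k : ℚ) + 1 ≠ 0 := by positivity
  have h2 : ∑ r ∈ Finset.range k, bernoulli (r + 1) / (r + 1) * (k.choose r : ℚ)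
      = (∑ r ∈ Finset.range k, ((k + 1).choose (r + 1) : ℚ) * bernoulli (r + 1)) / (k + 1) := by
    rw [Finset.sum_div]
    refine Finset.sum_congr rfl fun r _ => ?_
    have hc : ((k : ℚ) + 1) * k.choose r = (k + 1).choose (r + 1) * (r + 1) := by
      exact_mod_cast Nat.add_one_mul_choose_eq k r
    have hr : (r : ℚ) + 1 ≠ 0 := by positivity
    field_simp
    linear_combination bernoulli (r + 1) * hc
  rw [h2, eq_sub_of_add_eq h]
  rcases k with _ | k
  · simp
  · simp
    field_simp

/-- The summand `r = 0` gives `1/m`, the coefficient of `-log (1 - z)`. The others give the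
coefficients of `(z / (1 - z)^2)^(r+1)`, which vanish for `r ≥ m`, so any cutoff `N ≥ m` will do. -/
theorem modifiedNorlund_eq_sum (ℓ N m : ℕ) (hm : m ≠ 0) (hN : m < N + 1) :
    modifiedNorlund ℓ m = 1 / m + ∑ r ∈ Finset.range N,
      norlund ℓ (r + 1) / (2 * (r + 1)) * (if m < r + 1 then 0 else
        ((m - (r + 1) + (2 * r + 1)).choose (2 * r + 1) : ℚ)) := by
  have hm' : (m : ℚ) ≠ 0 := by exact_mod_cast hm
  rw [modifiedNorlund, Finset.sum_range_succ', add_comm]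
  congr 1
  · simp [norlund_zero_right]
  · rw [← Finset.sum_subset (Finset.range_subset_range.2 (Nat.lt_succ_iff.1 hN))]
    · refine Finset.sum_congr rfl fun r hr => ?_
      have hr := Finset.mem_range.1 hr
      rw [if_neg (by omega), show m - (r + 1) + (2 * r + 1) = m + r by omega]
      have hc : ((m : ℚ) + r + 1) * (m + r).choose (2 * r + 1)
          = (m + (r + 1)).choose (2 * (r + 1)) * (2 * (r + 1)) := by
        have := Nat.add_one_mul_choose_eq (m + r) (2 * r + 1)
        have := congrArg (Nat.cast : ℕ → ℚ) this
        push_cast at this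
        rw [show 2 * (r + 1) = 2 * r + 1 + 1 by ring, ← add_assoc m r 1]
        linear_combination this
      have h1 : (m : ℚ) + r + 1 ≠ 0 := by positivity
      have h1' : (m : ℚ) + (r + 1) ≠ 0 := by positivity
      have h2 : (r : ℚ) + 1 ≠ 0 := by positivity
      push_cast
      field_simp
      linear_combination -norlund ℓ (r + 1) * hc
    · intro r _ hr
      rw [if_pos (by simpa using hr), mul_zero]

/-! ### Asymptotics at infinity in sectors. -/

/-- The filter of neighbourhoods of infinity in the sector `|arg w| ≤ θ`. -/
noncomputable def sectorAtInf (θ : ℝ) : Filter ℂ := Bornology.cobounded ℂ ⊓ 𝓟 {w | |Complex.arg w| ≤ θ}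

theorem eventually_sectorAtInf_iff {θ : ℝ} {p : ℂ → Prop} :
    (∀ᶠ w in sectorAtInf θ, p w) ↔
      ∃ ρ : ℝ, 0 < ρ ∧ ∀ w : ℂ, ρ ≤ ‖w‖ → |Complex.arg w| ≤ θ → p w := by
  rw [sectorAtInf, eventually_inf_principal, hasBasis_cobounded_norm.eventually_iff]
  constructor
  · rintro ⟨ρ, -, h⟩
    exact ⟨max ρ 1, by positivity, fun w hw => h (le_trans (le_max_left _ _) hw)⟩
  · rintro ⟨ρ, -, h⟩
    exact ⟨ρ, trivial, fun w hw => h w hw⟩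

theorem isBigO_sectorAtInf_iff {θ : ℝ} {f : ℂ → ℂ} {m : ℕ} :
    f =O[sectorAtInf θ] (fun w => w⁻¹ ^ m) ↔
      ∃ C ρ : ℝ, 0 < ρ ∧ ∀ w : ℂ, ρ ≤ ‖w‖ → |Complex.arg w| ≤ θ → ‖f w‖ ≤ C * ‖w‖⁻¹ ^ m := by
  simp only [isBigO_iff, eventually_sectorAtInf_iff, norm_pow, norm_inv]

theorem tendsto_inv_sectorAtInf (θ : ℝ) : Tendsto (fun w : ℂ => w⁻¹) (sectorAtInf θ) (𝓝 0) :=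
  tendsto_inv₀_cobounded.mono_left inf_le_left

theorem eventually_slitPlane_sectorAtInf {θ : ℝ} (hθ : θ < Real.pi) :
    ∀ᶠ w in sectorAtInf θ, w ∈ Complex.slitPlane := by
  rw [eventually_sectorAtInf_iff]
  refine ⟨1, one_pos, fun w hw ha => Complex.mem_slitPlane_iff_arg.2 ⟨?_, ?_⟩⟩
  · intro h
    rw [h, abs_of_pos Real.pi_pos] at ha
    linarith
  · rintro rfl
    simp at hw
    linarith

theorem isBigO_inv_pow_sectorAtInf {θ : ℝ} {m n : ℕ} (h : m ≤ n) :
    (fun w : ℂ => w⁻¹ ^ n) =O[sectorAtInf θ] fun w => w⁻¹ ^ m := by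
  obtain ⟨d, rfl⟩ := Nat.exists_eq_add_of_le h
  simp only [pow_add]
  simpa using (isBigO_refl (fun w : ℂ => w⁻¹ ^ m) (sectorAtInf θ)).mul
    (((tendsto_inv_sectorAtInf θ).pow d).isBigO_one ℂ)

/-- Cauchy's estimate on a disc about `w` of radius proportional to `‖w‖`, which lies in a slightly
wider sector, gains one power of `w⁻¹`. -/
theorem isBigO_deriv_sectorAtInf {R : ℂ → ℂ} {m : ℕ}
    (hd : DifferentiableOn ℂ R Complex.slitPlane)
    (hR : ∀ θ < Real.pi, R =O[sectorAtInf θ] fun w => w⁻¹ ^ m) {θ : ℝ} (hθ : θ < Real.pi) :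
    deriv R =O[sectorAtInf θ] fun w => w⁻¹ ^ (m + 1) := by
  set θ' := (θ + Real.pi) / 2 with hθ'
  have h1 : θ' < Real.pi := by linarith
  obtain ⟨C, ρ, hρ, hC⟩ := isBigO_sectorAtInf_iff.1 (hR θ' h1)
  have hc : ∀ᶠ s in 𝓝 (1 : ℂ), |Complex.arg s| < (Real.pi - θ) / 2 := by
    have : ContinuousAt (fun s => |Complex.arg s|) 1 :=
      (Complex.continuousAt_arg Complex.one_mem_slitPlane).abs
    refine this.eventually_lt continuousAt_const ?_
    simp
    linarith
  obtain ⟨ε₀, hε₀, hball⟩ := Metric.eventually_nhds_iff.1 hc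
  -- The first bound controls `arg (u / w)` on the disc, the second keeps `‖u‖ ≥ ‖w‖ / 2`.
  set ε := min (ε₀ / 2) (1 / 2)
  have hε : 0 < ε := by positivity
  have hε1 : ε ≤ 1 / 2 := min_le_right _ _
  have hε2 : ε < ε₀ := (min_le_left _ _).trans_lt (by linarith)
  rw [isBigO_sectorAtInf_iff]
  refine ⟨|C| * 2 ^ m / ε, 2 * ρ, by positivity, fun w hw ha => ?_⟩
  have hwpos : 0 < ‖w‖ := by linarith
  have hw0 : w ≠ 0 := norm_pos_iff.1 hwpos
  have key : ∀ u ∈ Metric.closedBall w (ε * ‖w‖), |Complex.arg u| ≤ θ' ∧ ‖w‖ / 2 ≤ ‖u‖ := by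
    intro u hu
    rw [mem_closedBall_iff_norm] at hu
    have hnorm : ‖w‖ / 2 ≤ ‖u‖ := by
      have h2 : ‖w‖ - ‖u - w‖ ≤ ‖u‖ := by
        have := norm_sub_norm_le w (w - u)
        rw [sub_sub_cancel, norm_sub_rev w u] at this
        exact this
      nlinarith
    refine ⟨?_, hnorm⟩
    have hv : |Complex.arg (u / w)| < (Real.pi - θ) / 2 := by
      apply hball
      rw [dist_eq_norm, div_sub_one hw0, norm_div, div_lt_iff₀ hwpos]
      exact hu.trans_lt (by gcongr)
    have hu0 : u ≠ 0 := norm_pos_iff.1 (by linarith)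
    have h3 := abs_lt.1 hv
    have h4 := abs_le.1 ha
    have : Complex.arg u = Complex.arg w + Complex.arg (u / w) := by
      rw [← Complex.arg_mul hw0 (div_ne_zero hu0 hw0), mul_div_cancel₀ _ hw0]
      constructor <;> linarith
    rw [this, abs_le]
    constructor <;> linarith
  have hsub : Metric.closedBall w (ε * ‖w‖) ⊆ Complex.slitPlane := by
    intro u hu
    obtain ⟨ha', hn⟩ := key u hu
    refine Complex.mem_slitPlane_iff_arg.2 ⟨?_, norm_pos_iff.1 (by linarith)⟩
    intro h
    rw [h, abs_of_pos Real.pi_pos] at ha'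
    linarith
  have hεw : 0 < ε * ‖w‖ := by positivity
  have := Complex.norm_deriv_le_of_forall_mem_sphere_norm_le (f := R) (c := w)
    (C := |C| * (2 * ‖w‖⁻¹) ^ m) hεw ?_ ?_
  · refine this.trans_eq ?_
    rw [mul_pow, pow_succ, div_eq_mul_inv, mul_inv, div_eq_mul_inv]
    ring
  · refine DifferentiableOn.diffContOnCl ?_
    rw [closure_ball _ hεw.ne']
    exact hd.mono hsub
  · intro u hu
    obtain ⟨ha', hn⟩ := key u (Metric.sphere_subset_closedBall hu)
    refine (hC u (by linarith) ha').trans ?_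
    have : ‖u‖⁻¹ ≤ 2 * ‖w‖⁻¹ := by
      rw [← inv_inv (2 : ℝ), ← mul_inv]
      apply inv_anti₀ (by positivity)
      linarith
    gcongr
    exact le_abs_self C

/-! ### Calculus of logarithmic expansions. -/

/-- `A w ~ log w + c + ∑ a r w ^ (-r-1)` as `w → ∞` in each sector `|arg w| ≤ θ < π`. -/
def HasLogExpansion (A : ℂ → ℂ) (c : ℂ) (a : ℕ → ℂ) : Prop :=
  ∀ N : ℕ, ∀ θ < Real.pi,
    (fun w => A w - (Complex.log w + c + ∑ r ∈ Finset.range N, a r * w⁻¹ ^ (r + 1)))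
      =O[sectorAtInf θ] fun w => w⁻¹ ^ (N + 1)

theorem isBigO_const_mul_inv_pow_sectorAtInf (a : ℕ → ℂ) (N : ℕ) (θ : ℝ) :
    (fun w : ℂ => a N * w⁻¹ ^ (N + 1)) =O[sectorAtInf θ] fun w => w⁻¹ ^ (N + 1) :=
  (isBigO_refl _ _).const_mul_left _

/-- A bound that is one power too weak suffices: apply it with one more term, which is itself of the
required order. -/
theorem hasLogExpansion_of_isBigO {A : ℂ → ℂ} {c : ℂ} {a : ℕ → ℂ}
    (h : ∀ N : ℕ, ∀ θ < Real.pi,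
      (fun w => A w - (Complex.log w + c + ∑ r ∈ Finset.range N, a r * w⁻¹ ^ (r + 1)))
        =O[sectorAtInf θ] fun w => w⁻¹ ^ N) : HasLogExpansion A c a := by
  intro N θ hθ
  have := (h (N + 1) θ hθ).add (isBigO_const_mul_inv_pow_sectorAtInf a N θ)
  refine this.congr_left fun w => ?_
  rw [Finset.sum_range_succ]
  ring

theorem HasLogExpansion.deriv {A : ℂ → ℂ} {c : ℂ} {a : ℕ → ℂ} (h : HasLogExpansion A c a)
    (hd : DifferentiableOn ℂ A Complex.slitPlane) (N : ℕ) {θ : ℝ} (hθ : θ < Real.pi) :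
    (fun w => deriv A w - (w⁻¹ - ∑ r ∈ Finset.range N, (r + 1) * a r * w⁻¹ ^ (r + 2)))
      =O[sectorAtInf θ] fun w => w⁻¹ ^ (N + 2) := by
  have hder : ∀ w ∈ Complex.slitPlane, HasDerivAt
      (fun w => A w - (Complex.log w + c + ∑ r ∈ Finset.range N, a r * w⁻¹ ^ (r + 1)))
      (_root_.deriv A w - (w⁻¹ - ∑ r ∈ Finset.range N, (r + 1) * a r * w⁻¹ ^ (r + 2))) w := by
    intro w hw
    have hw0 := Complex.slitPlane_ne_zero hw
    have h1 : HasDerivAt (fun w : ℂ => ∑ r ∈ Finset.range N, a r * w⁻¹ ^ (r + 1))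
        (∑ r ∈ Finset.range N, -((r + 1) * a r * w⁻¹ ^ (r + 2))) w := by
      refine HasDerivAt.fun_sum fun r _ => ?_
      refine (((hasDerivAt_inv hw0).fun_pow (r + 1)).const_mul (a r)).congr_deriv ?_
      simp
      field_simp
      ring
    refine ((hd.differentiableAt (Complex.isOpen_slitPlane.mem_nhds hw)).hasDerivAt.sub
      (((Complex.hasDerivAt_log hw).add_const c).add h1)).congr_deriv ?_
    simp [sub_eq_add_neg]
  refine (isBigO_deriv_sectorAtInf (fun w hw => (hder w hw).differentiableAt.differentiableWithinAt)
    (h N) hθ).congr' ?_ EventuallyEq.rfl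
  filter_upwards [eventually_slitPlane_sectorAtInf hθ] with w hw using (hder w hw).deriv

theorem HasLogExpansion.linear_mul_deriv_add {A : ℂ → ℂ} {c : ℂ} {a : ℕ → ℂ}
    (h : HasLogExpansion A c a) (hd : DifferentiableOn ℂ A Complex.slitPlane) {k : ℂ} (hk : k ≠ 0)
    {b : ℕ → ℂ} (hb0 : b 0 = a 0 + 1 - a 0 / k)
    (hb : ∀ r, b (r + 1) = a (r + 1) - (r + 1) * a r - (r + 2) / k * a (r + 1)) :
    HasLogExpansion (fun w => (w + k) / k * _root_.deriv A w + A w) (c + 1 / k) b := by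
  intro N θ hθ
  -- `d n` is the coefficient of `w⁻¹ ^ (n + 1)` in `A'`. The expansion of `A'` is known one order
  -- further than needed, so the truncated sums differ by the single term `d N * w⁻¹ ^ (N + 1)`.
  obtain ⟨d, hd0, hds⟩ : ∃ d : ℕ → ℂ, d 0 = 1 ∧ ∀ n, d (n + 1) = -(n + 1) * a n :=
    ⟨fun n => Nat.rec 1 (fun n _ => -(n + 1) * a n) n, rfl, fun n => rfl⟩
  have hsum : ∀ (N : ℕ) (v : ℂ), v + ∑ r ∈ Finset.range N, (a r - (r + 1) * a r / k) * v ^ (r + 1)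
      - ∑ r ∈ Finset.range N, (r + 1) * a r * v ^ (r + 2)
      - ∑ r ∈ Finset.range N, b r * v ^ (r + 1) = d N * v ^ (N + 1) := by
    intro N v
    induction N with
    | zero => simp [hd0]
    | succ n ih =>
      simp only [Finset.sum_range_succ]
      have hbn : b n = a n - (n + 1) * a n / k + d n := by
        rcases n with _ | n
        · rw [hb0, hd0]
          simp
          ring
        · rw [hb, hds]
          push_cast
          ring
      rw [hbn, hds]
      linear_combination ih
  have h1 := h N θ hθ
  have h2 := h.deriv hd N hθ
  have h3 : (fun w : ℂ => (w + k) / k) =O[sectorAtInf θ] fun w => w := by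
    refine IsBigO.trans (g := fun w => w + k) ?_ ?_
    · simp only [div_eq_inv_mul]
      exact (isBigO_refl _ _).const_mul_left _
    · refine (isBigO_refl _ _).add (isLittleO_const_left.2 (Or.inr ?_)).isBigO
      exact tendsto_norm_cobounded_atTop.mono_left inf_le_left
  have h4 := ((h3.mul h2).congr' EventuallyEq.rfl ?_).add
    (h1.add ((isBigO_refl (fun w : ℂ => w⁻¹ ^ (N + 1)) (sectorAtInf θ)).const_mul_left (d N)))
  · refine h4.congr' ?_ EventuallyEq.rfl
    filter_upwards [eventually_slitPlane_sectorAtInf hθ] with w hw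
    have hw0 := Complex.slitPlane_ne_zero hw
    rw [← hsum]
    have e1 : ∑ r ∈ Finset.range N, (a r - (r + 1) * a r / k) * w⁻¹ ^ (r + 1)
        = ∑ r ∈ Finset.range N, a r * w⁻¹ ^ (r + 1)
          - w / k * ∑ r ∈ Finset.range N, (r + 1) * a r * w⁻¹ ^ (r + 2) := by
      rw [Finset.mul_sum, ← Finset.sum_sub_distrib]
      refine Finset.sum_congr rfl fun r _ => ?_
      rw [pow_succ _ (r + 1)]
      field_simp
    rw [e1]
    field_simp
    ring
  · filter_upwards [eventually_slitPlane_sectorAtInf hθ] with w hw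
    rw [pow_succ' _ (N + 1), mul_inv_cancel_left₀ (Complex.slitPlane_ne_zero hw)]

/-! ### Stirling's expansion of the digamma function. -/

/-- For `s = 1/(v+1)` one has `s / (1 - s) = 1/v`, and the left side is the increment from `v` to `v
+ 1` of the remainder of `ψ(v+1)`. Its Taylor coefficients up to `s^N` vanish by
`sum_bernoulli_mul_choose_div`. -/
theorem isBigO_bernoulli_telescope (N : ℕ) :
    (fun s : ℂ => s + Complex.log (1 - s) + ∑ r ∈ Finset.range N,
        (bernoulli (r + 1) / (r + 1) : ℂ) * (s ^ (r + 1) - (s / (1 - s)) ^ (r + 1)))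
      =O[𝓝 0] fun s => s ^ (N + 1) := by
  set c : ℕ → ℂ := fun m => (if m = 1 then 1 else 0) - 1 / m + ∑ r ∈ Finset.range N,
    (bernoulli (r + 1) / (r + 1) : ℂ) * ((if m = r + 1 then 1 else 0)
      - if m < r + 1 then 0 else ((m - (r + 1) + r).choose r : ℂ)) with hc
  have hpow (p : ℕ) (s : ℂ) : HasSum (fun m => (if m = p then 1 else 0) * s ^ m) (s ^ p) := by
    convert hasSum_single (f := fun m => (if m = p then 1 else 0) * s ^ m) p ?_ using 1
    · simp
    · intro b hb
      simp [hb]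
  have hsum : ∀ s : ℂ, ‖s‖ < 1 → HasSum (fun m => c m * s ^ m) (s + Complex.log (1 - s)
      + ∑ r ∈ Finset.range N,
        (bernoulli (r + 1) / (r + 1) : ℂ) * (s ^ (r + 1) - (s / (1 - s)) ^ (r + 1))) := by
    intro s hs
    have h1 := (hpow 1 s).sub (Complex.hasSum_taylorSeries_neg_log hs)
    have h2 := h1.add (hasSum_sum fun r (_ : r ∈ Finset.range N) =>
      ((hpow (r + 1) s).sub (hasSum_pow_div_one_sub_pow (r + 1) r hs)).mul_left
        (bernoulli (r + 1) / (r + 1) : ℂ))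
    simp only [← div_pow, sub_neg_eq_add, pow_one s] at h2
    refine h2.congr_fun fun m => ?_
    simp only [hc, add_mul, sub_mul, Finset.sum_mul, mul_assoc, mul_sub]
    ring
  have hzero : ∀ m ∈ Finset.range (N + 1), c m = 0 := by
    intro m hm
    have hm := Finset.mem_range.1 hm
    rcases m with _ | k
    · simp only [hc]
      simp
    · have hk : k < N := by omega
      have hb := congrArg (Rat.cast : ℚ → ℂ) (sum_bernoulli_mul_choose_div k)
      push_cast at hb
      have h3 : ∑ r ∈ Finset.range N, (bernoulli (r + 1) / (r + 1) : ℂ)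
            * ((if k + 1 = r + 1 then 1 else 0)
              - if k + 1 < r + 1 then 0 else ((k + 1 - (r + 1) + r).choose r : ℂ))
          = -∑ r ∈ Finset.range k, (bernoulli (r + 1) / (r + 1) : ℂ) * (k.choose r : ℂ) := by
        -- Both parts vanish for `r > k` and cancel for `r = k`; only `r < k` contributes.
        rw [← Finset.sum_subset (Finset.range_subset_range.2 hk), Finset.sum_range_succ,
          ← Finset.sum_neg_distrib]
        · simp only [lt_irrefl, if_true, if_false, Nat.sub_self, zero_add, Nat.choose_self,
            Nat.cast_one, sub_self, mul_zero, add_zero]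
          refine Finset.sum_congr rfl fun r hr => ?_
          have hr := Finset.mem_range.1 hr
          rw [if_neg (by omega), if_neg (by omega), show k + 1 - (r + 1) + r = k by omega]
          ring
        · intro r _ hr
          have hr : k + 1 ≤ r := by simpa using hr
          rw [if_neg (by omega), if_pos (by omega)]
          ring
      simp only [hc]
      rw [h3, hb]
      split_ifs <;> simp_all
  refine (isBigO_sub_sum_range_of_hasSum hsum (N + 1)).congr_left fun s => ?_
  rw [sub_eq_self]
  exact Finset.sum_eq_zero fun m hm => by rw [hzero m hm, zero_mul]

/-- Off the real axis `v` and `1 + v⁻¹` have imaginary parts of opposite sign, so their arguments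
add without leaving `(-π, π)`. -/
theorem Complex.log_add_one_sub_log {v : ℂ} (hv : v ∈ Complex.slitPlane) (hv1 : v + 1 ≠ 0) :
    Complex.log v = Complex.log (v + 1) + Complex.log (1 - (v + 1)⁻¹) := by
  have hv0 := Complex.slitPlane_ne_zero hv
  have him : (1 + v⁻¹).im = -v.im / Complex.normSq v := by simp
  have hq : 1 + v⁻¹ ≠ 0 := by
    intro h
    apply hv1
    field_simp at h
    simpa using h
  have harg : v.arg + (1 + v⁻¹).arg ∈ Set.Ioo (-Real.pi) Real.pi ∧ (1 + v⁻¹).arg ≠ Real.pi := by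
    have hns := Complex.normSq_pos.2 hv0
    rcases lt_trichotomy v.im 0 with h | h | h
    · have h1 := Complex.arg_neg_iff.2 h
      have h2 : 0 < (1 + v⁻¹).im := by rw [him]; exact div_pos (by linarith) hns
      have h3 := Complex.arg_nonneg_iff.2 h2.le
      have h4 : (1 + v⁻¹).arg < Real.pi := Complex.arg_lt_pi_iff.2 (Or.inr h2.ne')
      have h5 := Complex.neg_pi_lt_arg v
      exact ⟨⟨by linarith, by linarith⟩, h4.ne⟩
    · have hre : 0 < v.re := by
        rcases hv with h' | h'
        · exact h'
        · exact absurd h h'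
      have e : v = (v.re : ℂ) := Complex.ext rfl (by simpa using h)
      have e2 : 1 + v⁻¹ = ((1 + v.re⁻¹ : ℝ) : ℂ) := by rw [e]; simp
      rw [e2, Complex.arg_ofReal_of_nonneg (by positivity), e,
        Complex.arg_ofReal_of_nonneg hre.le]
      have := Real.pi_pos
      exact ⟨⟨by linarith, by linarith⟩, this.ne⟩
    · have h1 := Complex.arg_nonneg_iff.2 h.le
      have h2 : (1 + v⁻¹).im < 0 := by rw [him]; exact div_neg_of_neg_of_pos (by linarith) hns
      have h3 := Complex.arg_neg_iff.2 h2
      have h4 : v.arg < Real.pi := Complex.arg_lt_pi_iff.2 (Or.inr h.ne')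
      have h5 := Complex.neg_pi_lt_arg (1 + v⁻¹)
      have := Real.pi_pos
      exact ⟨⟨by linarith, by linarith⟩, by linarith⟩
  have e3 : v + 1 = v * (1 + v⁻¹) := by field_simp
  have e4 : 1 - (v + 1)⁻¹ = (1 + v⁻¹)⁻¹ := by
    field_simp
    ring
  rw [e4, Complex.log_inv _ harg.2, e3,
    Complex.log_mul hv0 hq (Set.Ioo_subset_Ioc_self harg.1)]
  ring

theorem Complex.digamma_ofReal {x : ℝ} (hx : 0 < x) :
    Complex.digamma x = (deriv (Real.log ∘ Real.Gamma) x : ℝ) := by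
  have hne : ∀ m : ℕ, x ≠ -m := fun m => by
    have : (0 : ℝ) ≤ m := m.cast_nonneg
    linarith
  have hd := Real.differentiableAt_Gamma hne
  have hdc : DifferentiableAt ℂ Complex.Gamma x :=
    Complex.differentiableAt_Gamma _ fun m => by exact_mod_cast hne m
  have h1 : HasDerivAt (fun y : ℝ => Complex.Gamma y) (deriv Complex.Gamma x) x :=
    hdc.hasDerivAt.comp_ofReal
  have h2 : HasDerivAt (fun y : ℝ => Complex.Gamma y) (deriv Real.Gamma x : ℝ) x := by
    simp only [Complex.Gamma_ofReal]
    exact hd.hasDerivAt.ofReal_comp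
  rw [Complex.digamma_def, logDeriv_apply, h1.unique h2, Complex.Gamma_ofReal, Function.comp_def,
    deriv.log hd (Real.Gamma_pos_of_pos hx).ne']
  push_cast
  rfl

/-- By convexity of `log Γ` the derivative lies between the slopes over `[x, x+1]` and `[x+1, x+2]`,
which the functional equation evaluates. -/
theorem Real.deriv_log_Gamma_add_one_mem_Icc {x : ℝ} (hx : 0 < x) :
    deriv (Real.log ∘ Real.Gamma) (x + 1) ∈ Set.Icc (Real.log x) (Real.log (x + 1)) := by
  have hc := Real.convexOn_log_Gamma
  have hrec {y : ℝ} (hy : 0 < y) :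
      (Real.log ∘ Real.Gamma) (y + 1) = (Real.log ∘ Real.Gamma) y + Real.log y := by
    simp only [Function.comp_apply, Real.Gamma_add_one hy.ne',
      Real.log_mul hy.ne' (Real.Gamma_pos_of_pos hy).ne', add_comm]
  have hder : DifferentiableAt ℝ (Real.log ∘ Real.Gamma) (x + 1) := by
    refine (Real.differentiableAt_Gamma fun m => ?_).log (Real.Gamma_pos_of_pos (by linarith)).ne'
    have : (0 : ℝ) ≤ m := m.cast_nonneg
    linarith
  constructor
  · refine (le_of_eq ?_).trans <| hc.slope_le_deriv (Set.mem_Ioi.2 hx)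
      (Set.mem_Ioi.2 (by linarith : 0 < x + 1)) (by linarith) hder
    rw [slope_def_field, hrec hx]
    ring
  · refine (hc.deriv_le_slope (Set.mem_Ioi.2 (by linarith : 0 < x + 1))
      (Set.mem_Ioi.2 (by linarith : 0 < x + 1 + 1)) (by linarith) hder).trans (le_of_eq ?_)
    rw [slope_def_field, hrec (by linarith : 0 < x + 1)]
    ring

theorem norm_digamma_add_one_sub_log_le {x : ℝ} (hx : 0 < x) :
    ‖Complex.digamma (x + 1) - Complex.log x‖ ≤ 1 / x := by
  obtain ⟨h1, h2⟩ := Real.deriv_log_Gamma_add_one_mem_Icc hx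
  have h3 := Complex.digamma_ofReal (by linarith : 0 < x + 1)
  push_cast at h3
  rw [h3, ← Complex.ofReal_log hx.le, ← Complex.ofReal_sub, Complex.norm_real, Real.norm_eq_abs,
    abs_of_nonneg (by linarith)]
  have h4 : Real.log (x + 1) - Real.log x ≤ 1 / x := by
    rw [← Real.log_div (by positivity) hx.ne']
    refine (Real.log_le_sub_one_of_pos (by positivity)).trans (le_of_eq ?_)
    field_simp
    ring
  linarith

theorem ne_neg_nat_of_mem_slitPlane {w : ℂ} (hw : w ∈ Complex.slitPlane) (m : ℕ) : w ≠ -m := by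
  rintro rfl
  rcases hw with h | h
  · simp at h
    have : (0 : ℝ) ≤ m := m.cast_nonneg
    linarith
  · simp at h

theorem add_natCast_mem_slitPlane {w : ℂ} (hw : w ∈ Complex.slitPlane) (m : ℕ) :
    w + m ∈ Complex.slitPlane := by
  have : (0 : ℝ) ≤ m := m.cast_nonneg
  rcases hw with h | h
  · left
    simp
    linarith
  · right
    simpa using h

theorem analyticOnNhd_digamma_add_natCast (m : ℕ) :
    AnalyticOnNhd ℂ (fun w => Complex.digamma (w + m)) Complex.slitPlane := by
  refine DifferentiableOn.analyticOnNhd (fun w hw => ?_) Complex.isOpen_slitPlane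
  have h0 := ne_neg_nat_of_mem_slitPlane (add_natCast_mem_slitPlane hw m)
  have hdiff : DifferentiableOn ℂ Complex.Gamma Complex.slitPlane := fun u hu =>
    (Complex.differentiableAt_Gamma u (ne_neg_nat_of_mem_slitPlane hu)).differentiableWithinAt
  have h1 : DifferentiableAt ℂ Complex.digamma (w + m) := by
    rw [Complex.digamma_def]
    have h2 : DifferentiableAt ℂ (deriv Complex.Gamma) (w + m) :=
      (hdiff.deriv Complex.isOpen_slitPlane).differentiableAt
        (Complex.isOpen_slitPlane.mem_nhds (add_natCast_mem_slitPlane hw m))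
    exact h2.div (Complex.differentiableAt_Gamma _ h0) (Complex.Gamma_ne_zero h0)
  exact (h1.comp w (by fun_prop : DifferentiableAt ℂ (fun w : ℂ => w + m) w)).differentiableWithinAt

/-- The difference between `ψ (w + 1)` and the first terms of its asymptotic expansion. -/
noncomputable def digammaRemainder (N : ℕ) (w : ℂ) : ℂ :=
  Complex.digamma (w + 1) - (Complex.log w
    - ∑ r ∈ Finset.range N, (bernoulli (r + 1) / (r + 1) : ℂ) * w⁻¹ ^ (r + 1))

theorem digammaRemainder_succ (N : ℕ) (w : ℂ) :
    digammaRemainder (N + 1) w = digammaRemainder N w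
      + (bernoulli (N + 1) / (N + 1) : ℂ) * w⁻¹ ^ (N + 1) := by
  simp only [digammaRemainder, Finset.sum_range_succ]
  ring

theorem differentiableOn_digammaRemainder (N : ℕ) :
    DifferentiableOn ℂ (digammaRemainder N) Complex.slitPlane := by
  intro w hw
  have h1 := (analyticOnNhd_digamma_add_natCast 1 w hw).differentiableAt
  have h2 := (Complex.hasDerivAt_log hw).differentiableAt
  have h3 := differentiableAt_inv (𝕜 := ℂ) (Complex.slitPlane_ne_zero hw)
  rw [Nat.cast_one] at h1
  refine (h1.sub (h2.sub (DifferentiableAt.fun_sum fun r _ => ?_))).differentiableWithinAt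
  exact (h3.fun_pow _).const_mul _

theorem exists_norm_digammaRemainder_sub_le (N : ℕ) :
    ∃ C ρ : ℝ, 0 ≤ C ∧ 1 ≤ ρ ∧ ∀ v ∈ Complex.slitPlane, ρ ≤ ‖v + 1‖ →
      ‖digammaRemainder N (v + 1) - digammaRemainder N v‖ ≤ C * ‖v + 1‖⁻¹ ^ (N + 1) := by
  obtain ⟨C, hC, hb⟩ := (isBigO_bernoulli_telescope N).exists_nonneg
  obtain ⟨ε, hε, hball⟩ := Metric.eventually_nhds_iff.1 hb.bound
  refine ⟨C, max 1 (2 / ε), hC, le_max_left _ _, fun v hv hρ => ?_⟩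
  have hpos : 0 < ‖v + 1‖ := lt_of_lt_of_le one_pos ((le_max_left _ _).trans hρ)
  have hv1 : v + 1 ≠ 0 := norm_pos_iff.1 hpos
  have hv0 := Complex.slitPlane_ne_zero hv
  have hs : dist (v + 1)⁻¹ 0 < ε := by
    rw [dist_zero_right, norm_inv]
    refine inv_lt_of_inv_lt₀ hε (lt_of_lt_of_le ?_ ((le_max_right _ _).trans hρ))
    rw [inv_eq_one_div]
    gcongr
    norm_num
  have h := hball hs
  rw [norm_pow, norm_inv] at h
  refine (le_of_eq ?_).trans h
  congr 1
  have hpsi := Complex.digamma_apply_add_one (v + 1)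
    (by simpa using ne_neg_nat_of_mem_slitPlane (add_natCast_mem_slitPlane hv 1))
  have hinv : (v + 1)⁻¹ / (1 - (v + 1)⁻¹) = v⁻¹ := by
    have : 1 - (v + 1)⁻¹ = v / (v + 1) := by
      field_simp
      ring
    rw [this]
    field_simp
  simp only [digammaRemainder, hinv, mul_sub, Finset.sum_sub_distrib]
  rw [hpsi, Complex.log_add_one_sub_log hv hv1]
  ring

theorem digammaRemainder_sub_eq_sum (N n : ℕ) (w : ℂ) :
    digammaRemainder N (w + n) = digammaRemainder N w + ∑ k ∈ Finset.range n,
      (digammaRemainder N (w + k + 1) - digammaRemainder N (w + k)) := by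
  induction n with
  | zero => simp
  | succ n ih =>
    rw [Finset.sum_range_succ, ← add_assoc, ← ih]
    push_cast
    rw [← add_assoc]
    ring

theorem tendsto_inv_add_natCast (w : ℂ) : Tendsto (fun n : ℕ => (w + n)⁻¹) atTop (𝓝 0) :=
  tendsto_inv₀_cobounded.comp
    ((tendsto_const_add_cobounded w).comp tendsto_natCast_atTop_cobounded)

theorem tendsto_digammaRemainder_one_ofReal {x : ℝ} (hx : 0 < x) :
    Tendsto (fun n : ℕ => digammaRemainder 1 ((x : ℂ) + n)) atTop (𝓝 0) := by
  have h0 : Tendsto (fun n : ℕ => Complex.digamma ((x : ℂ) + n + 1) - Complex.log (x + n))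
      atTop (𝓝 0) := by
    have h1 : Tendsto (fun n : ℕ => 1 / (x + n)) atTop (𝓝 0) :=
      tendsto_const_nhds.div_atTop (tendsto_const_nhds.add_atTop tendsto_natCast_atTop_atTop)
    refine squeeze_zero_norm (fun n => ?_) h1
    have := norm_digamma_add_one_sub_log_le (by positivity : 0 < x + n)
    push_cast at this
    exact this
  have h2 := h0.add ((tendsto_inv_add_natCast x).const_mul (bernoulli 1 : ℂ))
  rw [mul_zero, add_zero] at h2
  refine h2.congr fun n => ?_
  simp [digammaRemainder]
  ring

/-- For `N = 1` the increments are `O(k⁻²)`, so on a half-plane the limit along `w + n` exists and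
is analytic in `w`. It vanishes on the real axis, hence identically, and every `w` enters the
half-plane after finitely many shifts. -/
theorem tendsto_digammaRemainder_one (w : ℂ) :
    Tendsto (fun n : ℕ => digammaRemainder 1 (w + n)) atTop (𝓝 0) := by
  obtain ⟨C, ρ, hC, hρ, hbound⟩ := exists_norm_digammaRemainder_sub_le 1
  set U : Set ℂ := {w | ρ < w.re} with hU
  have hUopen : IsOpen U := isOpen_lt continuous_const Complex.continuous_re
  have hUconv : Convex ℝ U := convex_halfSpace_re_gt ρ
  have hUslit : U ⊆ Complex.slitPlane := fun w hw => Or.inl (by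
    have : ρ < w.re := hw
    linarith)
  have hadd {w : ℂ} (hw : w ∈ U) (k : ℕ) : w + k ∈ U := by
    have : (0 : ℝ) ≤ k := k.cast_nonneg
    have h : ρ < w.re := hw
    simp [hU]
    linarith
  set F : ℕ → ℂ → ℂ := fun k w => digammaRemainder 1 (w + k + 1) - digammaRemainder 1 (w + k)
  have hFle : ∀ k, ∀ w ∈ U, ‖F k w‖ ≤ C * (1 / ((k : ℝ) + 1) ^ 2) := by
    intro k w hw
    have hre : ρ + k + 1 ≤ ‖w + k + 1‖ := by
      refine le_trans ?_ (Complex.re_le_norm _)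
      have : ρ < w.re := hw
      simp
      linarith
    have hk : (0 : ℝ) ≤ k := k.cast_nonneg
    refine (hbound (w + k) (hUslit (hadd hw k)) (by linarith)).trans ?_
    rw [one_div, inv_pow]
    gcongr
    linarith
  have hsummable : Summable fun k : ℕ => C * (1 / ((k : ℝ) + 1) ^ 2) := by
    refine Summable.mul_left _ ?_
    exact_mod_cast (summable_nat_add_iff 1).2 (Real.summable_one_div_nat_pow.2 one_lt_two)
  have hdiffE : DifferentiableOn ℂ (digammaRemainder 1) U :=
    (differentiableOn_digammaRemainder 1).mono hUslit
  have hdiffF : ∀ k, DifferentiableOn ℂ (F k) U := by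
    intro k
    refine DifferentiableOn.fun_sub ?_ ?_
    · refine hdiffE.comp (g := digammaRemainder 1) (by fun_prop) fun w hw => ?_
      simpa [add_assoc] using hadd hw (k + 1)
    · exact hdiffE.comp (g := digammaRemainder 1) (by fun_prop) fun w hw => hadd hw k
  set Λ : ℂ → ℂ := fun w => digammaRemainder 1 w + ∑' k, F k w
  have hΛ : AnalyticOnNhd ℂ Λ U :=
    (hdiffE.fun_add (Complex.differentiableOn_tsum_of_summable_norm hsummable hdiffF hUopen
      hFle)).analyticOnNhd hUopen
  have hlim : ∀ w ∈ U, Tendsto (fun n : ℕ => digammaRemainder 1 (w + n)) atTop (𝓝 (Λ w)) := by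
    intro w hw
    have : Summable fun k => F k w :=
      Summable.of_norm_bounded hsummable fun k => hFle k w hw
    exact (this.hasSum.tendsto_sum_nat.const_add _).congr fun n =>
      (digammaRemainder_sub_eq_sum 1 n w).symm
  have hreal : ∀ x : ℝ, ρ < x → Λ x = 0 := fun x hx =>
    tendsto_nhds_unique (hlim x (by simpa [hU] using hx))
      (tendsto_digammaRemainder_one_ofReal (by linarith))
  have hzero : Set.EqOn Λ 0 U := by
    refine hΛ.eqOn_of_preconnected_of_frequently_eq (z₀ := ((ρ + 1 : ℝ) : ℂ))
      analyticOnNhd_const hUconv.isPreconnected (by simp [hU]) ?_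
    have h1 : Tendsto (fun n : ℕ => ((ρ + 1 + 1 / ((n : ℝ) + 1) : ℝ) : ℂ)) atTop
        (𝓝[≠] ((ρ + 1 : ℝ) : ℂ)) := by
      refine tendsto_nhdsWithin_iff.2 ⟨?_, Eventually.of_forall fun n => ?_⟩
      · have := (tendsto_one_div_add_atTop_nhds_zero_nat (𝕜 := ℝ)).const_add (ρ + 1)
        rw [add_zero] at this
        exact (Complex.continuous_ofReal.tendsto _).comp this
      · have : (0 : ℝ) < 1 / ((n : ℝ) + 1) := by positivity
        simp only [Set.mem_compl_iff, Set.mem_singleton_iff, Complex.ofReal_inj]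
        linarith
    refine h1.frequently (Eventually.of_forall fun n => ?_).frequently
    have : (0 : ℝ) < 1 / ((n : ℝ) + 1) := by positivity
    exact hreal _ (by linarith)
  obtain ⟨m, hm⟩ := exists_nat_gt (ρ - w.re)
  have hmU : w + m ∈ U := by
    simp [hU]
    linarith
  have := hlim _ hmU
  rw [hzero hmU] at this
  rw [← tendsto_add_atTop_iff_nat m]
  refine this.congr fun n => ?_
  push_cast
  congr 1
  ring

theorem tendsto_digammaRemainder_succ (N : ℕ) (w : ℂ) :
    Tendsto (fun n : ℕ => digammaRemainder (N + 1) (w + n)) atTop (𝓝 0) := by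
  induction N with
  | zero => exact tendsto_digammaRemainder_one w
  | succ N ih =>
    have h := ih.add (((tendsto_inv_add_natCast w).pow (N + 2)).const_mul
      (bernoulli (N + 2) / ((N + 1 : ℕ) + 1) : ℂ))
    rw [zero_pow (by omega), mul_zero, add_zero] at h
    exact h.congr fun n => (digammaRemainder_succ (N + 1) (w + n)).symm

/-- Expanding `‖w + t‖²` and using `cos (arg w) ≥ cos θ > -1` gives `‖w + t‖² ≥ δ (‖w‖² + t²)`. -/
theorem exists_mul_le_norm_add_of_abs_arg_le {θ : ℝ} (hθ : θ < Real.pi) :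
    ∃ c : ℝ, 0 < c ∧ ∀ w : ℂ, |Complex.arg w| ≤ θ → ∀ t : ℝ, 0 ≤ t →
      c * ‖w‖ ≤ ‖w + t‖ ∧ c * t ≤ ‖w + t‖ := by
  rcases lt_or_ge θ 0 with h0 | h0
  · exact ⟨1, one_pos, fun w hw => absurd (abs_nonneg _) (not_le.2 (hw.trans_lt h0))⟩
  have hcos : -1 < Real.cos θ := by
    rw [← Real.cos_pi]
    exact Real.cos_lt_cos_of_nonneg_of_le_pi h0 le_rfl hθ
  set δ := min 1 (1 + Real.cos θ)
  have hδ : 0 < δ := lt_min one_pos (by linarith)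
  have hδ1 : δ ≤ 1 := min_le_left _ _
  have hδ2 : δ ≤ 1 + Real.cos θ := min_le_right _ _
  refine ⟨δ, hδ, fun w hw t ht => ?_⟩
  have hre : ‖w‖ * (δ - 1) ≤ w.re := by
    rw [← Complex.norm_mul_cos_arg]
    gcongr
    have : Real.cos θ ≤ Real.cos (Complex.arg w) := by
      rw [← Real.cos_abs (Complex.arg w)]
      exact Real.cos_le_cos_of_nonneg_of_le_pi (abs_nonneg _) hθ.le hw
    linarith
  have hsq : ‖w + t‖ ^ 2 = ‖w‖ ^ 2 + 2 * t * w.re + t ^ 2 := by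
    rw [Complex.sq_norm, Complex.sq_norm, Complex.normSq_apply, Complex.normSq_apply]
    simp
    ring
  have hlow : δ * (‖w‖ ^ 2 + t ^ 2) ≤ ‖w + t‖ ^ 2 := by
    have := mul_le_mul_of_nonneg_left hre (by positivity : 0 ≤ 2 * t)
    have h2 := mul_nonneg (by linarith : 0 ≤ 1 - δ) (sq_nonneg (‖w‖ - t))
    nlinarith
  have hδδ : δ ^ 2 ≤ δ := by nlinarith
  constructor
  · refine le_of_sq_le_sq ?_ (norm_nonneg _)
    nlinarith [mul_nonneg hδ.le (sq_nonneg t), mul_le_mul_of_nonneg_right hδδ (sq_nonneg ‖w‖)]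
  · refine le_of_sq_le_sq ?_ (norm_nonneg _)
    nlinarith [mul_nonneg hδ.le (sq_nonneg ‖w‖), mul_le_mul_of_nonneg_right hδδ (sq_nonneg t)]

/-- Of the `N + 2` powers of `‖w + k + 1‖⁻¹` bounding an increment, `N` are spent on `‖w‖⁻¹` and two
on summability in `k`. The loss is made good by `hasLogExpansion_of_isBigO`. -/
theorem isBigO_digammaRemainder_succ (N : ℕ) {θ : ℝ} (hθ : θ < Real.pi) :
    digammaRemainder (N + 1) =O[sectorAtInf θ] fun w => w⁻¹ ^ N := by
  obtain ⟨C, ρ, hC, hρ, hbound⟩ := exists_norm_digammaRemainder_sub_le (N + 1)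
  obtain ⟨c, hc, hcw⟩ := exists_mul_le_norm_add_of_abs_arg_le hθ
  obtain ⟨ρ', hρ', hslit⟩ := eventually_sectorAtInf_iff.1 (eventually_slitPlane_sectorAtInf hθ)
  have hsummable : Summable fun k : ℕ => 1 / ((k : ℝ) + 1) ^ 2 := by
    exact_mod_cast (summable_nat_add_iff 1).2 (Real.summable_one_div_nat_pow.2 one_lt_two)
  set S := ∑' k : ℕ, 1 / ((k : ℝ) + 1) ^ 2
  rw [isBigO_sectorAtInf_iff]
  refine ⟨C * c⁻¹ ^ (N + 2) * S, max ρ' (ρ / c), by positivity, fun w hw ha => ?_⟩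
  have hws := hslit w ((le_max_left _ _).trans hw) ha
  have hwpos : 0 < ‖w‖ := norm_pos_iff.2 (Complex.slitPlane_ne_zero hws)
  have hρw : ρ ≤ c * ‖w‖ := by
    rw [mul_comm, ← div_le_iff₀ hc]
    exact (le_max_right _ _).trans hw
  have hterm : ∀ k : ℕ,
      ‖digammaRemainder (N + 1) (w + k + 1) - digammaRemainder (N + 1) (w + k)‖
        ≤ C * c⁻¹ ^ (N + 2) * ‖w‖⁻¹ ^ N * (1 / ((k : ℝ) + 1) ^ 2) := by
    intro k
    obtain ⟨h1, h2⟩ := hcw w ha ((k : ℝ) + 1) (by positivity)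
    push_cast at h1 h2
    rw [← add_assoc] at h1 h2
    refine (hbound _ (add_natCast_mem_slitPlane hws k) (hρw.trans h1)).trans ?_
    have e : C * c⁻¹ ^ (N + 2) * ‖w‖⁻¹ ^ N * (1 / ((k : ℝ) + 1) ^ 2)
        = C * ((c * ‖w‖)⁻¹ ^ N * (c * ((k : ℝ) + 1))⁻¹ ^ 2) := by
      rw [mul_inv, mul_inv, mul_pow, mul_pow, pow_add, one_div, inv_pow ((k : ℝ) + 1)]
      ring
    rw [e, show N + 1 + 1 = N + 2 by ring, pow_add]
    gcongr
  refine ge_of_tendsto' (x := atTop) (f := fun n : ℕ => ‖digammaRemainder (N + 1) (w + n)‖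
    + C * c⁻¹ ^ (N + 2) * S * ‖w‖⁻¹ ^ N) ?_ fun n => ?_
  · simpa using (tendsto_digammaRemainder_succ N w).norm.add_const
      (C * c⁻¹ ^ (N + 2) * S * ‖w‖⁻¹ ^ N)
  · rw [eq_sub_of_add_eq (digammaRemainder_sub_eq_sum (N + 1) n w).symm]
    refine (norm_sub_le _ _).trans ?_
    gcongr
    refine (norm_sum_le _ _).trans ((Finset.sum_le_sum fun k _ => hterm k).trans ?_)
    rw [← Finset.mul_sum, mul_right_comm]
    gcongr
    exact hsummable.sum_le_tsum _ fun k _ => by positivity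

theorem hasLogExpansion_digamma_add_one :
    HasLogExpansion (fun w => Complex.digamma (w + 1)) 0
      (fun r => -((norlund 1 (r + 1) : ℂ) / (r + 1))) := by
  apply hasLogExpansion_of_isBigO
  intro N θ hθ
  have h := (isBigO_digammaRemainder_succ N hθ).sub
    ((isBigO_inv_pow_sectorAtInf N.le_succ).const_mul_left (bernoulli (N + 1) / (N + 1) : ℂ))
  refine h.congr_left fun w => ?_
  rw [digammaRemainder_succ]
  simp only [digammaRemainder, norlund_one_left, neg_mul, Finset.sum_neg_distrib, pow_succ]
  ring

/-! ### Derivatives of binomial times digamma. -/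

theorem genBinom_succ (x : ℂ) (k : ℕ) :
    genBinom x (k + 1) = x / (k + 1) * genBinom (x - 1) k := by
  have h1 : (k : ℂ) + 1 ≠ 0 := by exact_mod_cast k.succ_ne_zero
  have h2 : (k.factorial : ℂ) ≠ 0 := by exact_mod_cast k.factorial_ne_zero
  simp only [genBinom, Finset.prod_range_succ', Nat.factorial_succ]
  push_cast
  have h3 : ∏ i ∈ Finset.range k, (x - ((i : ℂ) + 1)) = ∏ i ∈ Finset.range k, (x - 1 - i) :=
    Finset.prod_congr rfl fun i _ => by ring
  rw [h3, sub_zero]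
  field_simp

theorem differentiable_genBinom_add (c : ℂ) (k : ℕ) :
    Differentiable ℂ fun u => genBinom (u + c) k := by
  unfold genBinom
  fun_prop

theorem AnalyticOnNhd.iteratedDeriv {f : ℂ → ℂ} {s : Set ℂ} (hf : AnalyticOnNhd ℂ f s) (n : ℕ) :
    AnalyticOnNhd ℂ (iteratedDeriv n f) s := by
  rw [iteratedDeriv_eq_iterate]
  exact hf.iterated_deriv n

theorem iteratedDeriv_succ_add_const_mul {g : ℂ → ℂ} {s : Set ℂ} (hs : IsOpen s)
    (hg : AnalyticOnNhd ℂ g s) (c : ℂ) (n : ℕ) {w : ℂ} (hw : w ∈ s) :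
    iteratedDeriv (n + 1) (fun u => (u + c) * g u) w
      = (w + c) * iteratedDeriv (n + 1) g w + (n + 1) * iteratedDeriv n g w := by
  have hder (m : ℕ) {w : ℂ} (hw : w ∈ s) :
      HasDerivAt (iteratedDeriv m g) (iteratedDeriv (m + 1) g w) w := by
    rw [iteratedDeriv_succ]
    exact ((hg.iteratedDeriv m) w hw).differentiableAt.hasDerivAt
  induction n generalizing w with
  | zero =>
    have h := ((hasDerivAt_id w).add_const c).mul (hder 0 hw)
    rw [iteratedDeriv_zero] at h
    rw [zero_add, iteratedDeriv_one]
    refine h.deriv.trans ?_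
    simp
    ring
  | succ n ih =>
    rw [iteratedDeriv_succ, EventuallyEq.deriv_eq (show _ =ᶠ[𝓝 w] fun w =>
      (w + c) * iteratedDeriv (n + 1) g w + (n + 1) * iteratedDeriv n g w from by
        filter_upwards [hs.mem_nhds hw] with u hu using ih hu)]
    refine ((((hasDerivAt_id w).add_const c).mul (hder (n + 1) hw)).add
      ((hder n hw).const_mul ((n : ℂ) + 1))).deriv.trans ?_
    simp
    ring

theorem Polynomial.iteratedDeriv_eval_eq (p : Polynomial ℂ) (n : ℕ) :
    iteratedDeriv n (fun x => p.eval x) = fun x => (Polynomial.derivative^[n] p).eval x := by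
  induction n with
  | zero => simp
  | succ n ih =>
    ext x
    rw [iteratedDeriv_succ, ih, Function.iterate_succ_apply', Polynomial.deriv]

/-- `(d/dw) ^ k {binom(w + k, k) ψ(w + 1)}`. -/
noncomputable def derivBinomDigamma (k : ℕ) : ℂ → ℂ :=
  iteratedDeriv k fun u => genBinom (u + k) k * Complex.digamma (u + 1)

theorem analyticOnNhd_binom_mul_digamma (k j : ℕ) :
    AnalyticOnNhd ℂ (fun u => genBinom (u + k) k * Complex.digamma (u + j))
      Complex.slitPlane :=
  AnalyticOnNhd.mul (fun u _ => (differentiable_genBinom_add k k).analyticAt u)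
    (analyticOnNhd_digamma_add_natCast j)

theorem differentiableOn_derivBinomDigamma (k : ℕ) :
    DifferentiableOn ℂ (derivBinomDigamma k) Complex.slitPlane := by
  have := (analyticOnNhd_binom_mul_digamma k 1).iteratedDeriv k
  rw [Nat.cast_one] at this
  exact this.differentiableOn

/-- The new binomial is the old one times the linear factor `(u+k+1)/(k+1)`, so only two terms of
Leibniz' rule survive. -/
theorem derivBinomDigamma_succ (k : ℕ) {w : ℂ} (hw : w ∈ Complex.slitPlane) :
    derivBinomDigamma (k + 1) w = (w + ((k : ℂ) + 1)) / ((k : ℂ) + 1) * deriv (derivBinomDigamma k) w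
      + derivBinomDigamma k w := by
  have hk : (k : ℂ) + 1 ≠ 0 := by exact_mod_cast k.succ_ne_zero
  have hg := analyticOnNhd_binom_mul_digamma k 1
  rw [Nat.cast_one] at hg
  have e : (fun u : ℂ => genBinom (u + (k + 1 : ℕ)) (k + 1) * Complex.digamma (u + 1))
      = fun u => ((k : ℂ) + 1)⁻¹ *
        ((u + ((k : ℂ) + 1)) * (genBinom (u + k) k * Complex.digamma (u + 1))) := by
    ext u
    rw [genBinom_succ]
    push_cast
    rw [show u + ((k : ℂ) + 1) - 1 = u + k by ring]
    ring
  rw [derivBinomDigamma, e, iteratedDeriv_const_mul_field,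
    iteratedDeriv_succ_add_const_mul Complex.isOpen_slitPlane hg _ _ hw, iteratedDeriv_succ,
    derivBinomDigamma]
  field_simp

theorem hasLogExpansion_derivBinomDigamma (k : ℕ) :
    HasLogExpansion (derivBinomDigamma k) (harmonic k : ℂ)
      (fun r => -((norlund (k + 1) (r + 1) : ℂ) / (r + 1))) := by
  induction k with
  | zero =>
    convert hasLogExpansion_digamma_add_one using 1
    · ext w
      simp [derivBinomDigamma, genBinom]
    · simp
  | succ k ih =>
    have hk : (k : ℂ) + 1 ≠ 0 := by exact_mod_cast k.succ_ne_zero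
    have h := ih.linear_mul_deriv_add (differentiableOn_derivBinomDigamma k) hk
      (b := fun r => -((norlund (k + 2) (r + 1) : ℂ) / (r + 1))) ?_ ?_
    · intro N θ hθ
      refine (h N θ hθ).congr' ?_ EventuallyEq.rfl
      filter_upwards [eventually_slitPlane_sectorAtInf hθ] with w hw
      rw [derivBinomDigamma_succ k hw, harmonic_succ]
      push_cast
      rw [one_div]
    · have := congrArg (Rat.cast : ℚ → ℂ) (norlund_succ_left k 0)
      rw [norlund_zero_right] at this
      push_cast at this
      simp only [zero_add, CharP.cast_eq_zero] at this ⊢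
      rw [this]
      field_simp
      ring
    · intro r
      have := congrArg (Rat.cast : ℚ → ℂ) (norlund_succ_left k (r + 1))
      have h1 : (r : ℂ) + 1 ≠ 0 := by exact_mod_cast r.succ_ne_zero
      have h2 : (r : ℂ) + 1 + 1 ≠ 0 := by exact_mod_cast (r + 1).succ_ne_zero
      have h3 : (r : ℂ) + 2 = r + 1 + 1 := by ring
      push_cast at this ⊢
      rw [this, h3]
      field_simp
      ring

/-- Each unit shift of `ψ` adds `1/(u+j+1)`; for `j < k` the binomial contains this factor, so the
change is a polynomial of degree `< k`. -/
theorem iteratedDeriv_binom_mul_digamma_add {k j : ℕ} (hj : j ≤ k) {w : ℂ}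
    (hw : w ∈ Complex.slitPlane) :
    iteratedDeriv k (fun u => genBinom (u + k) k * Complex.digamma (u + (j + 1 : ℕ))) w
      = derivBinomDigamma k w := by
  induction j with
  | zero => simp [derivBinomDigamma]
  | succ j ih =>
    -- The index `i` for which the factor `u + k - i` equals `u + j + 1`.
    have hjk : k - 1 - j ∈ Finset.range k := Finset.mem_range.2 (by omega)
    set p : Polynomial ℂ := Polynomial.C ((k.factorial : ℂ)⁻¹) *
      ∏ i ∈ (Finset.range k).erase (k - 1 - j), (Polynomial.X + Polynomial.C ((k : ℂ) - i)) with hp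
    have hdeg : p.natDegree < k := by
      refine (Polynomial.natDegree_C_mul_le _ _).trans_lt
        ((Polynomial.natDegree_prod_le _ _).trans_lt ?_)
      simp only [Polynomial.natDegree_X_add_C, Finset.sum_const, smul_eq_mul, mul_one,
        Finset.card_erase_of_mem hjk, Finset.card_range]
      omega
    have heq : (fun u => genBinom (u + k) k * Complex.digamma (u + (j + 1 + 1 : ℕ))) =ᶠ[𝓝 w]
        fun u => genBinom (u + k) k * Complex.digamma (u + (j + 1 : ℕ)) + p.eval u := by
      filter_upwards [Complex.isOpen_slitPlane.mem_nhds hw] with u hu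
      have hu' := add_natCast_mem_slitPlane hu (j + 1)
      have hne := Complex.slitPlane_ne_zero hu'
      have hpu : genBinom (u + k) k = (u + (j + 1 : ℕ)) * p.eval u := by
        have hcast : ((k - 1 - j : ℕ) : ℂ) = k - 1 - j := by
          rw [Nat.sub_sub, Nat.cast_sub (by omega)]
          push_cast
          ring
        rw [genBinom, ← Finset.mul_prod_erase _ _ hjk, hcast, hp, Polynomial.eval_mul,
          Polynomial.eval_prod]
        simp only [Polynomial.eval_add, Polynomial.eval_X, Polynomial.eval_C, add_sub_assoc]
        push_cast
        ring
      have hpsi := Complex.digamma_apply_add_one _ (ne_neg_nat_of_mem_slitPlane hu')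
      rw [Nat.cast_succ (j + 1), ← add_assoc, hpsi, mul_add, hpu]
      field_simp
    have hpz : iteratedDeriv k (fun u => p.eval u) w = 0 := by
      rw [Polynomial.iteratedDeriv_eval_eq, Polynomial.iterate_derivative_eq_zero hdeg]
      exact Polynomial.eval_zero
    rw [heq.iteratedDeriv_eq, iteratedDeriv_fun_add, ih (by omega), hpz, add_zero]
    · exact (analyticOnNhd_binom_mul_digamma k (j + 1) w hw).contDiffAt
    · exact (p.differentiable.analyticAt w).contDiffAt

/-! ### Return to the variable `z`. -/

theorem norlundClosedForm_succ (k : ℕ) {z : ℂ} (hz : z + 1 / z - 2 ∈ Complex.slitPlane) :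
    norlundClosedForm (k + 1) z = -(1 / 2) * Complex.log z
      + (1 / 2) * ((harmonic k : ℂ) - derivBinomDigamma k (z + 1 / z - 2)) := by
  have hk : k - (k + 1) / 2 ≤ k := Nat.sub_le _ _
  have hsum : (((k + 1) / 2 : ℕ) : ℂ) + (k - (k + 1) / 2 : ℕ) = k := by
    rw [← Nat.cast_add]
    congr 1
    omega
  have hshift := congrFun (iteratedDeriv_comp_add_const k (fun x : ℂ =>
    genBinom (x - 1) k * Complex.digamma (x - (((k + 1) / 2 : ℕ) : ℂ))) ((k : ℂ) + 1))
    (z + 1 / z - 2)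
  rw [norlundClosedForm, Nat.add_sub_cancel, ← iteratedDeriv_binom_mul_digamma_add hk hz,
    show z + 1 / z + ((k + 1 : ℕ) : ℂ) - 2 = z + 1 / z - 2 + ((k : ℂ) + 1) by push_cast; ring,
    ← hshift]
  congr 4
  ext u
  congr 2
  · ring
  · push_cast
    linear_combination -hsum

/-- For `|arg (1 - z)| < (π - θ)/4` the arguments in `(1 - z)^2 / z` add up to at most `(θ + π)/2 <
π` in modulus, so the principal logarithms add. -/
theorem eventually_log_add_inv_sub_two {θ : ℝ} (hθ : θ < Real.pi) :
    ∀ᶠ z in 𝓝[{z : ℂ | z ≠ 0 ∧ |Complex.arg z| ≤ θ}] 0,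
      |Complex.arg (z + 1 / z - 2)| ≤ (θ + Real.pi) / 2 ∧
      Complex.log (z + 1 / z - 2) = 2 * Complex.log (1 - z) - Complex.log z := by
  have hc : ∀ᶠ z in 𝓝 (0 : ℂ), |Complex.arg (1 - z)| < (Real.pi - θ) / 4 := by
    have h1 : ContinuousAt (fun z : ℂ => |Complex.arg (1 - z)|) 0 := by
      refine ContinuousAt.abs (ContinuousAt.comp (g := Complex.arg) ?_ (by fun_prop))
      exact Complex.continuousAt_arg (by simp)
    refine h1.eventually_lt continuousAt_const ?_
    simp
    linarith
  have hne : ∀ᶠ z in 𝓝 (0 : ℂ), z ≠ 1 := isOpen_ne.mem_nhds zero_ne_one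
  filter_upwards [self_mem_nhdsWithin, nhdsWithin_le_nhds hc, nhdsWithin_le_nhds hne]
    with z ⟨hz0, hz⟩ hz1 hz2
  have h10 : 1 - z ≠ 0 := sub_ne_zero.2 hz2.symm
  have hzpi : Complex.arg z ≠ Real.pi := by
    intro h
    rw [h, abs_of_pos Real.pi_pos] at hz
    linarith
  have hinv : Complex.arg z⁻¹ = -Complex.arg z := by rw [Complex.arg_inv, if_neg hzpi]
  obtain ⟨a1, a2⟩ := abs_le.1 hz
  obtain ⟨b1, b2⟩ := abs_lt.1 hz1
  have m1 : (1 - z).arg + (z⁻¹).arg ∈ Set.Ioc (-Real.pi) Real.pi := by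
    rw [hinv]
    constructor <;> linarith
  have e1 := Complex.arg_mul h10 (inv_ne_zero hz0) m1
  have m2 : (1 - z).arg + ((1 - z) * z⁻¹).arg ∈ Set.Ioc (-Real.pi) Real.pi := by
    rw [e1, hinv]
    constructor <;> linarith
  have e2 : z + 1 / z - 2 = (1 - z) * ((1 - z) * z⁻¹) := by
    field_simp
    ring
  have hprod := mul_ne_zero h10 (inv_ne_zero hz0)
  rw [e2, Complex.arg_mul h10 hprod m2, Complex.log_mul h10 hprod m2,
    Complex.log_mul h10 (inv_ne_zero hz0) m1, Complex.log_inv _ hzpi, e1, hinv]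
  refine ⟨abs_le.2 ⟨by linarith, by linarith⟩, by ring⟩

theorem add_inv_sub_two_inv {z : ℂ} (hz : z ≠ 0) :
    (z + 1 / z - 2)⁻¹ = z / (1 - z) ^ 2 := by
  rw [show z + 1 / z - 2 = (1 - z) ^ 2 / z by field_simp; ring, inv_div]

theorem tendsto_add_inv_sub_two_sectorAtInf {θ : ℝ} (hθ : θ < Real.pi) :
    Tendsto (fun z : ℂ => z + 1 / z - 2) (𝓝[{z : ℂ | z ≠ 0 ∧ |Complex.arg z| ≤ θ}] 0)
      (sectorAtInf ((θ + Real.pi) / 2)) := by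
  rw [sectorAtInf, tendsto_inf, tendsto_principal]
  refine ⟨?_, (eventually_log_add_inv_sub_two hθ).mono fun z hz => hz.1⟩
  have h1 : Tendsto (fun z : ℂ => (z / (1 - z) ^ 2)⁻¹) (𝓝[≠] 0) (Bornology.cobounded ℂ) := by
    refine tendsto_inv₀_nhdsNE_zero.comp (tendsto_nhdsWithin_iff.2 ⟨?_, ?_⟩)
    · have : ContinuousAt (fun z : ℂ => z / (1 - z) ^ 2) 0 :=
        ContinuousAt.div (by fun_prop) (by fun_prop) (by simp)
      simpa using this.tendsto.mono_left nhdsWithin_le_nhds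
    · have hne : ∀ᶠ z in 𝓝 (0 : ℂ), z ≠ 1 := isOpen_ne.mem_nhds zero_ne_one
      filter_upwards [self_mem_nhdsWithin, nhdsWithin_le_nhds hne] with z hz hz1
      exact div_ne_zero hz (pow_ne_zero _ (sub_ne_zero.2 hz1.symm))
  have h2 := h1.mono_left (nhdsWithin_mono 0 fun z (hz : z ≠ 0 ∧ |Complex.arg z| ≤ θ) => hz.1)
  refine h2.congr' ?_
  filter_upwards [self_mem_nhdsWithin] with z hz
  rw [← add_inv_sub_two_inv hz.1, inv_inv]

theorem isBigO_modifiedNorlund_sub (ℓ N : ℕ) :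
    (fun z : ℂ => -Complex.log (1 - z) + ∑ r ∈ Finset.range N,
        (norlund ℓ (r + 1) / (2 * (r + 1)) : ℂ) * (z / (1 - z) ^ 2) ^ (r + 1)
      - ∑ n ∈ Finset.range N, PowerSeries.coeff n (modifiedNorlundGenFun ℓ) * z ^ n)
      =O[𝓝 0] fun z => z ^ N := by
  set c : ℕ → ℂ := fun m => 1 / m + ∑ r ∈ Finset.range N,
    (norlund ℓ (r + 1) / (2 * (r + 1)) : ℂ) * (if m < r + 1 then 0 else
      ((m - (r + 1) + (2 * r + 1)).choose (2 * r + 1) : ℂ)) with hc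
  have hsum : ∀ z : ℂ, ‖z‖ < 1 → HasSum (fun m => c m * z ^ m)
      (-Complex.log (1 - z) + ∑ r ∈ Finset.range N,
        (norlund ℓ (r + 1) / (2 * (r + 1)) : ℂ) * (z / (1 - z) ^ 2) ^ (r + 1)) := by
    intro z hz
    have h := (Complex.hasSum_taylorSeries_neg_log hz).add
      (hasSum_sum fun r (_ : r ∈ Finset.range N) =>
        (hasSum_pow_div_one_sub_pow (r + 1) (2 * r + 1) hz).mul_left
          (norlund ℓ (r + 1) / (2 * (r + 1)) : ℂ))
    simp only [show ∀ r, 2 * r + 1 + 1 = 2 * (r + 1) from fun r => by ring, pow_mul (1 - z),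
      ← div_pow] at h
    refine h.congr_fun fun m => ?_
    simp only [hc, add_mul, Finset.sum_mul, mul_assoc]
    ring
  refine (isBigO_sub_sum_range_of_hasSum hsum N).congr_left fun z => ?_
  congr 1
  refine Finset.sum_congr rfl fun m hm => ?_
  congr 1
  rw [modifiedNorlundGenFun, PowerSeries.coeff_mk]
  rcases eq_or_ne m 0 with rfl | hm0
  -- At `m = 0` the convention `1 / 0 = 0` gives the correct zero constant term.
  · simp [hc]
  · rw [if_neg hm0, modifiedNorlund_eq_sum ℓ N m hm0 ((Finset.mem_range.1 hm).trans N.lt_succ_self)]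
    simp only [hc]
    push_cast
    congr 1
    refine Finset.sum_congr rfl fun r _ => ?_
    split_ifs <;> simp

theorem mainTheorem1 (ℓ : ℕ) (hℓ : 1 ≤ ℓ) :
    HasFormalExpansionAtZero (norlundClosedForm ℓ) (modifiedNorlundGenFun ℓ) := by
  obtain ⟨k, rfl⟩ := Nat.exists_eq_add_of_le' hℓ
  intro θ _ hθ N
  have hθ' : (θ + Real.pi) / 2 < Real.pi := by linarith
  have htend := tendsto_add_inv_sub_two_sectorAtInf hθ
  have h1 := ((hasLogExpansion_derivBinomDigamma k N _ hθ').comp_tendsto htend).const_mul_left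
    (-(1 / 2))
  have h2 : ((fun w : ℂ => w⁻¹ ^ (N + 1)) ∘ fun z : ℂ => z + 1 / z - 2)
      =O[𝓝[{z : ℂ | z ≠ 0 ∧ |Complex.arg z| ≤ θ}] 0] fun z => z ^ N := by
    have hcont : ContinuousAt (fun z : ℂ => z * ((1 - z) ^ 2)⁻¹ ^ (N + 1)) 0 :=
      continuousAt_id.mul ((ContinuousAt.inv₀ (by fun_prop) (by simp)).pow _)
    have h := (isBigO_refl (fun z : ℂ => z ^ N) (𝓝 0)).mul (hcont.tendsto.isBigO_one ℂ)
    simp only [mul_one] at h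
    refine (h.mono nhdsWithin_le_nhds).congr' ?_ EventuallyEq.rfl
    filter_upwards [self_mem_nhdsWithin] with z hz
    rw [Function.comp_apply, add_inv_sub_two_inv hz.1, div_eq_mul_inv, mul_pow, pow_succ z]
    ring
  have h3 := (isBigO_modifiedNorlund_sub (k + 1) N).mono
    (nhdsWithin_le_nhds (s := {z : ℂ | z ≠ 0 ∧ |Complex.arg z| ≤ θ}))
  refine ((h1.trans h2).add h3).congr' ?_ EventuallyEq.rfl
  filter_upwards [self_mem_nhdsWithin, eventually_log_add_inv_sub_two hθ,
    htend.eventually (eventually_slitPlane_sectorAtInf hθ')] with z hz hlog hslit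
  have hs : ∑ r ∈ Finset.range N, (norlund (k + 1) (r + 1) / (2 * (r + 1)) : ℂ)
        * (z / (1 - z) ^ 2) ^ (r + 1)
      = -(1 / 2) * ∑ r ∈ Finset.range N, -((norlund (k + 1) (r + 1) : ℂ) / (r + 1))
        * (z / (1 - z) ^ 2) ^ (r + 1) := by
    rw [Finset.mul_sum]
    refine Finset.sum_congr rfl fun r _ => ?_
    have : (r : ℂ) + 1 ≠ 0 := by exact_mod_cast r.succ_ne_zero
    field_simp
  rw [norlundClosedForm_succ k hslit, Function.comp_apply, hlog.2, add_inv_sub_two_inv hz.1, hs]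
  ring
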